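/- **Setting.** A contextual POMDP has a finite context set $\mathcal C=\{1,\dots,N\}$, measurable state, action and observation spaces $\mathcal S,\mathcal A,\mathcal O$ (the $\sigma$-algebras of $\mathcal A$ and $\mathcal O$ countably generated), and for each context $c$ a transition kernel $P_c:\mathcal S\times\mathcal A\to\mathrm{Dist}(\mathcal S)$, an emission kernel $E_c:\mathcal S\to\mathrm{Dist}(\mathcal O)$, a measurable reward function $r_c$ with $|r_c|\le R_{\max}$ (where $R_{\max}>0$), and an initial state distribution $\mu_c$. A policy draws the action $A_t$ from a distribution that depends on $(O_{0:t},A_{0:t-1})$; $\Pi$ is a given class of policies. For the horizon $T$ let $V_c(\pi)=\mathbb E_{c,\pi}\big[\sum_{t=0}^{T-1}r_c(S_t,A_t)\big]$, and assume that for each $c$ there is $\pi_c^\star\in\arg\max_{\pi\in\Pi}V_c(\pi)$. The true context $C=c^\star$ is drawn once from a prior on $\mathcal C$ and stays fixed during $K$ episodes. In episode $k=1,\dots,K$ a policy $\pi_k$, which is a measurable function of the past $\mathcal H_{k-1}=(Y^1,\dots,Y^{k-1})$, is run in context $c^\star$, and the trajectory $Y^k=(O^k_{0:T},A^k_{0:T-1})$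 is observed. Put $\bar V_k(\pi)=\sum_{c}\mathbb P(C=c\mid\mathcal H_{k-1})\,V_c(\pi)$, and let $I_k(\pi)=I(C;Y^k\mid\mathcal H_{k-1},\pi)$ be the mutual information, in nats, between the context, distributed according to the current posterior $\mathbb P(C\in\cdot\mid\mathcal H_{k-1})$, and the trajectory observed when $\pi$ is run for one episode. Let $H(C\mid\mathcal H_{k-1})$ and $I(C;Y^k\mid\mathcal H_{k-1})=\mathbb E[I_k(\pi_k)]$ be the conditional entropy and the conditional mutual information (averaged over the past), and let $\eta>0$ be a constant such that $$H(C\mid\mathcal H_{k-1})\le\tfrac1\eta\,I(C;Y^k\mid\mathcal H_{k-1})\qquad(k=1,\dots,K).$$ **Theorem (Bayesian regret of entropy-regularized CPOMDP).** There are universal constants $\xi,\kappa>0$ such that the following holds. Let $\tau>0$ and suppose that, almost surely, in each episode $$\pi_k\in\arg\max_{\pi\in\Pi}\big(\bar V_k(\pi)+\tau I_k(\pi)\big).$$ Then the expected Bayesian regret after $K$ episodes satisfies $$\mathbb E[\mathrm{BR}(K,T)]:=\mathbb E\Big[\sum_{k=1}^K\big(V_{c^\star}(\pi^\star_{c^\star})-V_{c^\star}(\pi_k)\big)\Big]\le\tau\log|\mathcal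 C|+\xi\,T R_{\max}\sqrt{\frac{K\log|\mathcal C|}{\eta}}+2\,T R_{\max}\sqrt{KT}.$$ In particular, $\mathbb E[\mathrm{BR}(K,T)]=O\big(T R_{\max}\sqrt{K\log|\mathcal C|/\eta}\big)$ as $K\to\infty$: there is $K_0$ depending only on $\tau,T,R_{\max},|\mathcal C|$ such that $\mathbb E[\mathrm{BR}(K,T)]\le\kappa\,T R_{\max}\sqrt{K\log|\mathcal C|/\eta}$ whenever $K\ge K_0$. -/

import Mathlib

open MeasureTheory ProbabilityTheory

noncomputable section

namespace CPOMDP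

/-- A full trajectory `((S_t, O_t)_{0 ≤ t ≤ T}, (A_t)_{0 ≤ t < T})` of one episode. -/
abbrev Traj (S A O : Type*) (T : ℕ) : Type _ := (Fin (T + 1) → S × O) × (Fin T → A)

/-- The part `(O_{0:T}, A_{0:T-1})` of a trajectory that the agent observes. -/
abbrev ObsTraj (A O : Type*) (T : ℕ) : Type _ := (Fin (T + 1) → O) × (Fin T → A)

/-- Forget the hidden states. -/
def Traj.observed {S A O : Type*} {T : ℕ} (x : Traj S A O T) : ObsTraj A O T :=
  (fun t => (x.1 t).2, x.2)

/-- Append an action, the next hidden state and the next observation. -/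
def Traj.snoc {S A O : Type*} {T : ℕ} (x : (Traj S A O T × A) × (S × O)) : Traj S A O (T + 1) :=
  (Fin.snoc (α := fun _ => S × O) x.1.1.1 x.2, Fin.snoc (α := fun _ => A) x.1.1.2 x.1.2)

end CPOMDP

/-- A contextual POMDP with contexts `Fin N`, state space `S`, action space `A`, observation
space `O`. -/
structure CPOMDP (N : ℕ) (S A O : Type*) [MeasurableSpace S] [MeasurableSpace A]
    [MeasurableSpace O] where
  /-- transition kernels `P_c : S × A → Dist(S)` -/
  trans : Fin N → Kernel (S × A) S
  /-- emission kernels `E_c : S → Dist(O)` -/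
  emit : Fin N → Kernel S O
  /-- reward functions `r_c` -/
  reward : Fin N → S → A → ℝ
  /-- initial state distributions `μ_c` -/
  init : Fin N → Measure S
  trans_markov : ∀ c, IsMarkovKernel (trans c)
  emit_markov : ∀ c, IsMarkovKernel (emit c)
  reward_measurable : ∀ c, Measurable (fun p : S × A => reward c p.1 p.2)
  init_prob : ∀ c, IsProbabilityMeasure (init c)

namespace CPOMDP

attribute [instance] trans_markov emit_markov init_prob

/-- A randomized, history-dependent policy: at time `t` it draws `A_t` from a distribution that
depends on `(O_{0:t}, A_{0:t-1})`. -/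
structure Policy (A O : Type*) [MeasurableSpace A] [MeasurableSpace O] where
  act : ∀ t : ℕ, Kernel (ObsTraj A O t) A
  act_markov : ∀ t, IsMarkovKernel (act t)

attribute [instance] Policy.act_markov

section

variable {N : ℕ} {S A O : Type*} [MeasurableSpace S] [MeasurableSpace A] [MeasurableSpace O]

theorem measurable_observed {T : ℕ} :
    Measurable (Traj.observed : Traj S A O T → ObsTraj A O T) := by
  unfold Traj.observed
  fun_prop

theorem measurable_snoc {T : ℕ} :
    Measurable (Traj.snoc : (Traj S A O T × A) × (S × O) → Traj S A O (T + 1)) := by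
  refine Measurable.prodMk (measurable_pi_lambda _ fun i => ?_) (measurable_pi_lambda _ fun i => ?_)
  · refine Fin.lastCases ?_ (fun j => ?_) i
    · simpa using measurable_snd
    · simp only [Fin.snoc_castSucc]; fun_prop
  · refine Fin.lastCases ?_ (fun j => ?_) i
    · simp only [Fin.snoc_last]; fun_prop
    · simp only [Fin.snoc_castSucc]; fun_prop

/-- The current hidden state, together with the chosen action. -/
def Traj.last {T : ℕ} (x : Traj S A O T × A) : S × A := ((x.1.1 (Fin.last T)).1, x.2)

theorem measurable_last {T : ℕ} :
    Measurable (Traj.last : Traj S A O T × A → S × A) := by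
  unfold Traj.last
  fun_prop

/-- One step of the environment in context `c`: from `(s, a)` draw `s' ∼ P_c(s, a)`, then
`o' ∼ E_c(s')`. -/
def stepKernel (M : CPOMDP N S A O) (c : Fin N) : Kernel (S × A) (S × O) :=
  (M.trans c) ⊗ₖ ((M.emit c).comap Prod.snd measurable_snd)

instance (M : CPOMDP N S A O) (c : Fin N) : IsMarkovKernel (M.stepKernel c) := by
  unfold stepKernel
  infer_instance

/-- The law of the trajectory up to time `T` when policy `π` is run in context `c`:
`S_0 ∼ μ_c`, `O_t ∼ E_c(S_t)`, `A_t ∼ π(O_{0:t}, A_{0:t-1})`, `S_{t+1} ∼ P_c(S_t, A_t)`. -/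
def trajLaw (M : CPOMDP N S A O) (c : Fin N) (π : Policy A O) : (T : ℕ) → Measure (Traj S A O T)
  | 0 => (M.init c ⊗ₘ M.emit c).map (fun p => (fun _ => p, Fin.elim0))
  | T + 1 => ((M.trajLaw c π T ⊗ₘ (π.act T).comap Traj.observed measurable_observed) ⊗ₘ
      (M.stepKernel c).comap Traj.last measurable_last).map Traj.snoc

instance (M : CPOMDP N S A O) (c : Fin N) (π : Policy A O) (T : ℕ) :
    IsProbabilityMeasure (M.trajLaw c π T) := by
  induction T with
  | zero => exact Measure.isProbabilityMeasure_map (by fun_prop)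
  | succ T ih => exact Measure.isProbabilityMeasure_map measurable_snoc.aemeasurable

/-- The episodic value `V_c(π) = E_π[∑_{t=0}^{T-1} r_c(S_t, A_t)]`. -/
def value (M : CPOMDP N S A O) (T : ℕ) (c : Fin N) (π : Policy A O) : ℝ :=
  ∫ x, ∑ t : Fin T, M.reward c (x.1 t.castSucc).1 (x.2 t) ∂(M.trajLaw c π T)

/-- The law of the observed trajectory `Y` when `π` is run in context `c`. -/
def obsLaw (M : CPOMDP N S A O) (T : ℕ) (c : Fin N) (π : Policy A O) : Measure (ObsTraj A O T) :=
  (M.trajLaw c π T).map Traj.observed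

/-- `c ↦` law of the observed trajectory, as a kernel. -/
def obsKernel (M : CPOMDP N S A O) (T : ℕ) (π : Policy A O) : Kernel (Fin N) (ObsTraj A O T) :=
  ⟨fun c => M.obsLaw T c π, measurable_from_top⟩

/-- The expected value `E_{c ∼ b}[V_c(π)]` under a belief `b` about the context. -/
def expectedValue (M : CPOMDP N S A O) (T : ℕ) (b : Measure (Fin N)) (π : Policy A O) : ℝ :=
  ∫ c, M.value T c π ∂b

/-- The mutual information (in nats) of two random variables with joint law `ρ`. -/
def mutualInfo {α β : Type*} [MeasurableSpace α] [MeasurableSpace β] (ρ : Measure (α × β)) : ℝ :=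
  (InformationTheory.klDiv ρ (ρ.fst.prod ρ.snd)).toReal

/-- The mutual information of the context and the observed trajectory when the context has
distribution `b` and the policy `π` is run for one episode. -/
def infoGain (M : CPOMDP N S A O) (T : ℕ) (b : Measure (Fin N)) (π : Policy A O) : ℝ :=
  mutualInfo (b ⊗ₘ M.obsKernel T π)

/-- The Shannon entropy (in nats) of a distribution on the contexts. -/
def entropy (b : Measure (Fin N)) : ℝ := ∑ c, Real.negMulLog (b.real {c})

/-- The conditional law of the observed trajectory of an episode, given the context and the
past `h`, when the policy `sel h` is run. -/
def episodeKernel {H : Type*} [MeasurableSpace H] (M : CPOMDP N S A O) (T : ℕ)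
    (sel : H → Policy A O) (hsel : ∀ c, Measurable fun h => M.trajLaw c (sel h) T) :
    Kernel (Fin N × H) (ObsTraj A O T) :=
  ⟨fun p => M.obsLaw T p.1 (sel p.2), measurable_from_prod_countable_right fun c =>
    (Measure.measurable_map _ measurable_observed).comp (hsel c)⟩

end

/-- `K` episodes of horizon `T` in the contextual POMDP `M`, on a probability space `(Ω, P)`. The
context is drawn once from the prior and then kept; episodes are numbered from `0`; in episode `k`
the policy `sel k h` is run in the true context, where `h` is the list of the trajectories observed
in the episodes before `k`. -/
structure Interaction {N : ℕ} {S A O Ω : Type*} [MeasurableSpace S] [MeasurableSpace A]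
    [MeasurableSpace O] [MeasurableSpace Ω] (M : CPOMDP N S A O) (T K : ℕ)
    (prior : Measure (Fin N)) (P : Measure Ω) where
  /-- the true context -/
  ctx : Ω → Fin N
  /-- the trajectory observed in episode `k` -/
  obs : ℕ → Ω → ObsTraj A O T
  /-- the policy selected in episode `k` on the basis of the past -/
  sel : ∀ k : ℕ, (Fin k → ObsTraj A O T) → Policy A O
  ctx_measurable : Measurable ctx
  obs_measurable : ∀ k, Measurable (obs k)
  /-- The selection is measurable: what it does depends measurably on the past. -/
  sel_measurable : ∀ k c, Measurable fun h => M.trajLaw c (sel k h) T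
  ctx_law : P.map ctx = prior
  /-- Given the context `c` and the past `h`, the observed trajectory of episode `k` is distributed
  as that of the policy `sel k h` in context `c`. -/
  obs_law : ∀ k < K,
    P.map (fun ω => ((ctx ω, fun i : Fin k => obs i ω), obs k ω)) =
      P.map (fun ω => (ctx ω, fun i : Fin k => obs i ω)) ⊗ₘ
        M.episodeKernel T (sel k) (sel_measurable k)

namespace Interaction

variable {N : ℕ} [NeZero N] {S A O Ω : Type*} [MeasurableSpace S] [MeasurableSpace A]
  [MeasurableSpace O] [MeasurableSpace Ω] {M : CPOMDP N S A O} {T K : ℕ}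
  {prior : Measure (Fin N)} {P : Measure Ω} [IsProbabilityMeasure P]

/-- The past of episode `k`: the trajectories observed in the episodes `0, …, k - 1`. -/
def hist (X : Interaction M T K prior P) (k : ℕ) (ω : Ω) : Fin k → ObsTraj A O T :=
  fun i => X.obs i ω

/-- The policy that is run in episode `k`. -/
def policy (X : Interaction M T K prior P) (k : ℕ) (ω : Ω) : Policy A O := X.sel k (X.hist k ω)

/-- The posterior distribution of the context at the beginning of episode `k`. -/
def posterior (X : Interaction M T K prior P) (k : ℕ) (ω : Ω) : Measure (Fin N) :=
  condDistrib X.ctx (X.hist k) P (X.hist k ω)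

/-- In every episode the policy maximizes, over the policy class `Pol`, the posterior-expected value
plus `τ` times the information gain about the context. -/
def IsCIDS (X : Interaction M T K prior P) (Pol : Set (Policy A O)) (τ : ℝ) : Prop :=
  ∀ k < K, ∀ᵐ ω ∂P, X.policy k ω ∈ Pol ∧
    IsMaxOn (fun π => M.expectedValue T (X.posterior k ω) π + τ * M.infoGain T (X.posterior k ω) π)
      Pol (X.policy k ω)

/-- The conditional entropy of the context given the past of episode `k`. -/
def condEntropy (X : Interaction M T K prior P) (k : ℕ) : ℝ :=
  ∫ ω, entropy (X.posterior k ω) ∂P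

/-- The conditional mutual information of the context and the trajectory observed in episode `k`,
given the past of episode `k`. -/
def condMutualInfo (X : Interaction M T K prior P) (k : ℕ) : ℝ :=
  ∫ ω, M.infoGain T (X.posterior k ω) (X.policy k ω) ∂P

/-- `η > 0` is a constant that relates the remaining uncertainty about the context to the
information gained in an episode: `H(C | past) ≤ I(C; Y^k | past) / η` in each of the `K`
episodes. -/
def IsInfoConstant (X : Interaction M T K prior P) (η : ℝ) : Prop :=
  0 < η ∧ ∀ k < K, X.condEntropy k ≤ 1 / η * X.condMutualInfo k

/-- The Bayesian regret after `K` episodes with respect to the policies `πstar c` (which are to be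
optimal for the contexts `c`). -/
def regret (X : Interaction M T K prior P) (πstar : Fin N → Policy A O) (ω : Ω) : ℝ :=
  ∑ k ∈ Finset.range K,
    (M.value T (X.ctx ω) (πstar (X.ctx ω)) - M.value T (X.ctx ω) (X.policy k ω))

end Interaction

end CPOMDP

end

/-! Fix an episode, let `b` be the posterior and let `i` be its most probable context. The selected
policy competes with `πstar i`; since the information gain of `πstar i` is nonnegative, the
posterior-expected regret is at most that of `πstar i` plus `τ` times the information gained.
Playing `πstar i` costs at most `2 * T * R` on the mass `1 - b {i}`, and `1 - b {i} ≤ min 1 (entropy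
b)` (`exists_one_sub_le_entropy`, `sum_regret_le`).

By the chain rule (`condMutualInfo_eq`) the expected gain in an episode is the drop of the
conditional entropy, so the gains sum to at most the initial entropy `H₀ ≤ log N`. This bounds the
regularization cost by `τ * log N`, and through the information constant it gives `∑ H_k ≤ H₀ / η`.
The sum of `min 1 H_k` is at most `K` and at most `H₀ / η`, hence at most the geometric mean `√(K *
H₀ / η)`.

The chain rule rests on Bayes' formula: the joint law has density posterior over prior with respect
to the product of its marginals, so mutual information is prior entropy minus mean posterior entropy
(`mutualInfo_eq_entropy_sub`). -/

/-! ### Countably generated σ-algebras on finite products. -/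

theorem MeasurableSpace.CountablyGenerated.iSup {ι α : Type*} [Finite ι]
    {m : ι → MeasurableSpace α} (h : ∀ i, @MeasurableSpace.CountablyGenerated α (m i)) :
    @MeasurableSpace.CountablyGenerated α (⨆ i, m i) := by
  choose b hb hm using fun i => (h i).isCountablyGenerated
  refine @MeasurableSpace.CountablyGenerated.mk _ (⨆ i, m i)
    ⟨⋃ i, b i, Set.countable_iUnion hb, ?_⟩
  rw [← MeasurableSpace.iSup_generateFrom]
  exact iSup_congr hm

/-- Makes the space of observed trajectories countably generated, as needed for the almost sure
uniqueness of disintegrations. -/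
instance MeasurableSpace.CountablyGenerated.pi {ι : Type*} [Finite ι] {α : ι → Type*}
    [∀ i, MeasurableSpace (α i)] [∀ i, MeasurableSpace.CountablyGenerated (α i)] :
    MeasurableSpace.CountablyGenerated (∀ i, α i) :=
  MeasurableSpace.CountablyGenerated.iSup fun i =>
    MeasurableSpace.CountablyGenerated.comap fun x : ∀ i, α i => x i

namespace CPOMDP

/-! ### Entropy of a belief on finitely many contexts. -/

section Entropy

variable {N : ℕ} (b : Measure (Fin N)) [IsProbabilityMeasure b]

theorem sum_real_singleton_eq_one : ∑ c, b.real {c} = 1 := by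
  rw [sum_measureReal_singleton, Finset.coe_univ, probReal_univ]

theorem entropy_nonneg : 0 ≤ entropy b :=
  Finset.sum_nonneg fun _ _ => Real.negMulLog_nonneg measureReal_nonneg measureReal_le_one

theorem entropy_le_log : entropy b ≤ Real.log N := by
  have hN : (0 : ℝ) < N := by
    rcases Nat.eq_zero_or_pos N with rfl | h
    · simpa using sum_real_singleton_eq_one b
    · exact_mod_cast h
  -- Jensen's inequality with uniform weights.
  have h := Real.concaveOn_negMulLog.le_map_sum (t := Finset.univ) (w := fun _ : Fin N => (N : ℝ)⁻¹)
    (p := fun c => b.real {c}) (fun _ _ => by positivity) (by simp [hN.ne'])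
    (fun _ _ => measureReal_nonneg)
  simp only [smul_eq_mul, ← Finset.mul_sum, sum_real_singleton_eq_one, mul_one] at h
  rw [Real.negMulLog, Real.log_inv] at h
  have h' : (N : ℝ)⁻¹ * entropy b ≤ (N : ℝ)⁻¹ * Real.log N := by
    simpa [entropy] using h
  exact le_of_mul_le_mul_left h' (by positivity)

/-- For the most probable `c`, `-log b_i ≥ 1 - b_i ≥ 1 - b_c` for every `i` of positive mass;
averaging over `i` with weights `b_i` gives the entropy on the left. -/
theorem exists_one_sub_le_entropy : ∃ c, 1 - b.real {c} ≤ entropy b := by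
  have hne : Nonempty (Fin N) := by
    by_contra h
    rw [not_nonempty_iff] at h
    simpa using sum_real_singleton_eq_one b
  obtain ⟨c, hc⟩ := Finite.exists_max fun c => b.real {c}
  refine ⟨c, ?_⟩
  calc 1 - b.real {c} = ∑ i, b.real {i} * (1 - b.real {c}) := by
        rw [← Finset.sum_mul, sum_real_singleton_eq_one, one_mul]
    _ ≤ entropy b := Finset.sum_le_sum fun i _ => ?_
  rcases (measureReal_nonneg (μ := b) (s := {i})).eq_or_lt with h0 | h0
  · simp [← h0]
  · have h1 := Real.log_le_sub_one_of_pos h0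
    have h2 := hc i
    rw [Real.negMulLog]
    nlinarith

theorem measurable_entropy {α : Type*} [MeasurableSpace α] (κ : Kernel α (Fin N)) :
    Measurable fun a => entropy (κ a) := by
  unfold entropy
  refine Finset.measurable_sum _ fun c _ => ?_
  exact Real.continuous_negMulLog.measurable.comp
    (κ.measurable_coe (measurableSet_singleton c)).ennreal_toReal

theorem integrable_entropy {α : Type*} [MeasurableSpace α] (κ : Kernel α (Fin N))
    [IsMarkovKernel κ] (μ : Measure α) [IsFiniteMeasure μ] :
    Integrable (fun a => entropy (κ a)) μ := by
  refine Integrable.of_bound (measurable_entropy κ).aestronglyMeasurable (Real.log N)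
    (Filter.Eventually.of_forall fun a => ?_)
  rw [Real.norm_of_nonneg (entropy_nonneg _)]
  exact entropy_le_log _

end Entropy

/-! ### Bayes' formula and mutual information. -/

section MutualInfo

variable {N : ℕ} {β : Type*} [MeasurableSpace β]

/-- Here `q` is the posterior given `y`: its mean is the prior. -/
theorem lintegral_singleton_of_map_swap_eq {ρ : Measure (Fin N × β)} {m : Measure β}
    [IsProbabilityMeasure m] {q : Kernel β (Fin N)} [IsMarkovKernel q]
    (h : ρ.map Prod.swap = m ⊗ₘ q) (c : Fin N) : ∫⁻ y, q y {c} ∂m = ρ.fst {c} := by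
  have h1 : (m ⊗ₘ q).snd {c} = ρ.fst {c} := by rw [← h, Measure.snd_map_swap]
  rw [← h1, Measure.snd_apply (measurableSet_singleton c),
    Measure.compProd_apply (measurable_snd (measurableSet_singleton c))]
  rfl

theorem measurable_singleton_div (q : Kernel β (Fin N)) (b : Measure (Fin N)) :
    Measurable fun p : Fin N × β => q p.2 {p.1} / b {p.1} := by
  refine measurable_from_prod_countable_right fun c => ?_
  exact (q.measurable_coe (measurableSet_singleton c)).div_const (b {c})

/-- A nonnegative posterior mass with mean zero vanishes almost surely. This makes the quotient
posterior over prior harmless at contexts of prior mass zero. -/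
theorem ae_singleton_eq_zero_of_map_swap_eq {ρ : Measure (Fin N × β)} {m : Measure β}
    [IsProbabilityMeasure m] {q : Kernel β (Fin N)} [IsMarkovKernel q]
    (h : ρ.map Prod.swap = m ⊗ₘ q) : ∀ᵐ y ∂m, ∀ c, ρ.fst {c} = 0 → q y {c} = 0 := by
  rw [ae_all_iff]
  intro c
  by_cases hc : ρ.fst {c} = 0
  · have := lintegral_singleton_of_map_swap_eq h c
    rw [hc, lintegral_eq_zero_iff (q.measurable_coe (measurableSet_singleton c))] at this
    filter_upwards [this] with y hy _ using hy
  · exact Filter.Eventually.of_forall fun y h0 => absurd h0 hc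

/-- Bayes' formula: on each slice `y`, multiplying the quotient by the prior mass restores the
posterior mass. -/
theorem eq_withDensity_of_map_swap_eq {ρ : Measure (Fin N × β)} [IsProbabilityMeasure ρ]
    {m : Measure β} [IsProbabilityMeasure m] {q : Kernel β (Fin N)} [IsMarkovKernel q]
    (h : ρ.map Prod.swap = m ⊗ₘ q) :
    ρ = (ρ.fst.prod m).withDensity fun p => q p.2 {p.1} / ρ.fst {p.1} := by
  have hf := measurable_singleton_div q ρ.fst
  have hae := ae_singleton_eq_zero_of_map_swap_eq h
  ext s hs
  have hρ : ρ = (m ⊗ₘ q).map Prod.swap := by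
    rw [← h, Measure.map_map measurable_swap measurable_swap]; simp
  rw [withDensity_apply _ hs, ← lintegral_indicator hs,
    lintegral_prod_symm' _ (hf.indicator hs)]
  conv_lhs => rw [hρ, Measure.map_apply measurable_swap hs,
    Measure.compProd_apply (measurable_swap hs)]
  refine lintegral_congr_ae ?_
  filter_upwards [hae] with y hy
  have hsy : MeasurableSet (Prod.mk y ⁻¹' (Prod.swap ⁻¹' s) : Set (Fin N)) :=
    measurable_prodMk_left (measurable_swap hs)
  rw [← lintegral_indicator_one hsy, lintegral_fintype, lintegral_fintype]
  refine Finset.sum_congr rfl fun c _ => ?_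
  by_cases hc : (c, y) ∈ s
  · simp only [Set.indicator, Set.mem_preimage, Prod.swap_prod_mk, hc, if_true, Pi.one_apply,
      one_mul]
    by_cases h0 : ρ.fst {c} = 0
    · simp [h0, hy c h0]
    · rw [ENNReal.div_mul_cancel h0 (measure_ne_top _ _)]
  · simp [Set.indicator, hc]

/-- Splits the divergence integrand into the posterior entropy, a cross term linear in `q`, and `b -
q`, which cancels in the sum over contexts. -/
theorem mul_klFun_div {q b : ℝ} (hb : b ≠ 0) :
    b * InformationTheory.klFun (q / b) = -Real.negMulLog q - q * Real.log b + b - q := by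
  rcases eq_or_ne q 0 with rfl | hq
  · simp [InformationTheory.klFun]
  · rw [InformationTheory.klFun, Real.log_div hq hb, Real.negMulLog]
    field_simp

/-- Mutual information is the entropy minus the expected entropy of the conditional
distribution. -/
theorem mutualInfo_eq_entropy_sub {ρ : Measure (Fin N × β)} [IsProbabilityMeasure ρ]
    {m : Measure β} [IsProbabilityMeasure m] {q : Kernel β (Fin N)} [IsMarkovKernel q]
    (h : ρ.map Prod.swap = m ⊗ₘ q) :
    mutualInfo ρ = entropy ρ.fst - ∫ y, entropy (q y) ∂m := by
  have hm : ρ.snd = m := by rw [← Measure.fst_map_swap, h, Measure.fst_compProd]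
  have hq : ∀ c, Measurable fun y => q y {c} :=
    fun c => q.measurable_coe (measurableSet_singleton c)
  set b := ρ.fst with hb
  have hf := measurable_singleton_div q b
  have hρ := eq_withDensity_of_map_swap_eq h
  have hac : ρ ≪ b.prod m := by
    rw [hρ]; exact withDensity_absolutelyContinuous _ _
  have hrn : ρ.rnDeriv (b.prod m) =ᵐ[b.prod m] fun p => q p.2 {p.1} / b {p.1} := by
    conv_lhs => rw [hρ]
    exact Measure.rnDeriv_withDensity _ hf
  have hfr : ∀ p : Fin N × β,
      (q p.2 {p.1} / b {p.1}).toReal = (q p.2).real {p.1} / b.real {p.1} := fun p =>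
    ENNReal.toReal_div _ _
  have hint : Integrable (fun p : Fin N × β =>
      InformationTheory.klFun ((q p.2).real {p.1} / b.real {p.1})) (b.prod m) := by
    -- The quotients lie in a compact interval, because `q ≤ 1` and null contexts contribute `0⁻¹ =
    -- 0`; the continuous `klFun` is bounded there.
    obtain ⟨B, hB⟩ := (isCompact_Icc (a := (0 : ℝ))
      (b := ∑ c, (b.real {c})⁻¹)).exists_bound_of_continuousOn
      InformationTheory.continuous_klFun.continuousOn
    refine Integrable.of_bound ?_ B (Filter.Eventually.of_forall fun p => hB _ ⟨?_, ?_⟩)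
    · simp_rw [← hfr]
      exact (InformationTheory.continuous_klFun.measurable.comp
        hf.ennreal_toReal).aestronglyMeasurable
    · positivity
    · calc (q p.2).real {p.1} / b.real {p.1} ≤ 1 / b.real {p.1} := by
            gcongr; exact measureReal_le_one
        _ = (b.real {p.1})⁻¹ := one_div _
        _ ≤ _ := Finset.single_le_sum (f := fun c => (b.real {c})⁻¹)
            (fun _ _ => by positivity) (Finset.mem_univ p.1)
  have hqint : ∀ c, Integrable (fun y => (q y).real {c}) m := fun c =>
    Integrable.of_bound (hq c).ennreal_toReal.aestronglyMeasurable 1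
      (Filter.Eventually.of_forall fun y => by
        rw [Real.norm_of_nonneg measureReal_nonneg]; exact measureReal_le_one)
  have hqb : ∀ c, ∫ y, (q y).real {c} ∂m = b.real {c} := fun c => by
    have := integral_toReal (hq c).aemeasurable
      (Filter.Eventually.of_forall fun y => measure_lt_top (q y) {c} : ∀ᵐ y ∂m, q y {c} < ⊤)
    simp only [Measure.real]
    rw [this, lintegral_singleton_of_map_swap_eq h c]
  have hae := ae_singleton_eq_zero_of_map_swap_eq h
  rw [mutualInfo, hm, ← hb, InformationTheory.toReal_klDiv_eq_integral_klFun hac]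
  calc ∫ p, InformationTheory.klFun (ρ.rnDeriv (b.prod m) p).toReal ∂(b.prod m)
      = ∫ p, InformationTheory.klFun ((q p.2).real {p.1} / b.real {p.1}) ∂(b.prod m) := by
        refine integral_congr_ae ?_
        filter_upwards [hrn] with p hp
        rw [hp, hfr]
    _ = ∫ y, ∫ c, InformationTheory.klFun ((q y).real {c} / b.real {c}) ∂b ∂m :=
        integral_prod_symm _ hint
    _ = ∫ y, (-entropy (q y) - ∑ c, (q y).real {c} * Real.log (b.real {c})) ∂m := by
        refine integral_congr_ae ?_
        filter_upwards [hae] with y hy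
        rw [integral_fintype Integrable.of_finite]
        -- At a null context both sides vanish, since the posterior mass is zero there as well.
        have : ∀ c, b.real {c} • InformationTheory.klFun ((q y).real {c} / b.real {c}) =
            -Real.negMulLog ((q y).real {c}) - (q y).real {c} * Real.log (b.real {c})
              + b.real {c} - (q y).real {c} := fun c => by
          by_cases h0 : b {c} = 0
          · simp [Measure.real, h0, hy c h0]
          · exact mul_klFun_div (by simpa [measureReal_eq_zero_iff] using h0)
        simp_rw [this, Finset.sum_sub_distrib, Finset.sum_add_distrib, Finset.sum_sub_distrib,
          sum_real_singleton_eq_one, Finset.sum_neg_distrib, entropy]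
        ring
    _ = entropy b - ∫ y, entropy (q y) ∂m := by
        -- The cross term is linear in the posterior, whose mean is `b`; it therefore integrates to
        -- the prior entropy.
        have hne : Integrable (fun y => -entropy (q y)) m := (integrable_entropy q m).neg
        rw [integral_sub hne
          (integrable_finsetSum _ fun c _ => (hqint c).mul_const _), integral_neg,
          integral_finsetSum _ fun c _ => (hqint c).mul_const _]
        simp_rw [integral_mul_const, hqb, entropy, Real.negMulLog, neg_mul,
          Finset.sum_neg_distrib]
        ring

end MutualInfo

/-! ### Conditional laws and the expected drop of entropy. -/

section Bayes

variable {N : ℕ} {Ω α β : Type*} [MeasurableSpace Ω] [MeasurableSpace α] [MeasurableSpace β]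
  {P : Measure Ω} [IsProbabilityMeasure P] {C : Ω → Fin N} {X : Ω → α} {Y : Ω → β}

/-- If `b` is the conditional law of `C` given `X`, `κ` that of `Y` given `(C, X)`, and `q` that of
`C` given `(X, Y)`, then, given `X`, the conditional law of `(C, Y)` disintegrates through `b` and
`κ` as well as through its second marginal and `q`. -/
theorem ae_map_swap_compProd_eq [MeasurableSpace.CountablyGenerated β]
    (hC : Measurable C) (hX : Measurable X) (hY : Measurable Y)
    {b : Kernel α (Fin N)} [IsMarkovKernel b] (hb : P.map X ⊗ₘ b = P.map fun ω => (X ω, C ω))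
    {κ : Kernel (Fin N × α) β} [IsMarkovKernel κ]
    (hκ : P.map (fun ω => ((C ω, X ω), Y ω)) = P.map (fun ω => (C ω, X ω)) ⊗ₘ κ)
    {q : Kernel (α × β) (Fin N)} [IsMarkovKernel q]
    (hq : P.map (fun ω => (X ω, Y ω)) ⊗ₘ q = P.map fun ω => ((X ω, Y ω), C ω)) :
    ∃ m : Kernel α β, IsMarkovKernel m ∧ P.map X ⊗ₘ m = P.map (fun ω => (X ω, Y ω)) ∧
      ∀ᵐ x ∂P.map X,
        (b x ⊗ₘ (κ.comap Prod.swap measurable_swap).sectR x).map Prod.swap =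
          m x ⊗ₘ q.sectR x := by
  set κ' := κ.comap Prod.swap measurable_swap with hκ'
  have := Measure.isProbabilityMeasure_map hX.aemeasurable (μ := P)
  have hbκ : P.map X ⊗ₘ (b ⊗ₖ κ') = P.map fun ω => (X ω, C ω, Y ω) := by
    have h1 : P.map (fun ω => (X ω, C ω)) ⊗ₘ κ' = P.map fun ω => ((X ω, C ω), Y ω) := by
      have e1 : P.map (fun ω => (X ω, C ω)) = (P.map fun ω => (C ω, X ω)).map Prod.swap := by
        rw [Measure.map_map measurable_swap (by fun_prop)]; rfl
      have e2 : P.map (fun ω => ((X ω, C ω), Y ω)) =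
          (P.map fun ω => ((C ω, X ω), Y ω)).map (Prod.map Prod.swap id) := by
        rw [Measure.map_map (by fun_prop) (by fun_prop)]; rfl
      have := Measure.isProbabilityMeasure_map (hC.prodMk hX).aemeasurable (μ := P)
      have := Measure.isProbabilityMeasure_map (hX.prodMk hC).aemeasurable (μ := P)
      rw [e2, hκ]
      ext s hs
      rw [Measure.map_apply (by fun_prop) hs, Measure.compProd_apply hs,
        Measure.compProd_apply ((by fun_prop : Measurable _) hs), e1,
        lintegral_map (Kernel.measurable_kernel_prodMk_left hs) measurable_swap]
      rfl
    rw [← Measure.compProd_assoc', hb, h1, Measure.map_map (by fun_prop) (by fun_prop)]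
    rfl
  have hm : P.map X ⊗ₘ (b ⊗ₖ κ').snd = P.map fun ω => (X ω, Y ω) := by
    have : P.map (fun ω => (X ω, Y ω)) =
        (P.map fun ω => (X ω, C ω, Y ω)).map (Prod.map id Prod.snd) := by
      rw [Measure.map_map (by fun_prop) (by fun_prop)]; rfl
    rw [this, ← hbκ, Kernel.snd_eq, Measure.compProd_map measurable_snd]
  refine ⟨(b ⊗ₖ κ').snd, inferInstance, hm, ?_⟩
  -- Composed with the law of `X`, both kernels give the law of `(X, (Y, C))`. Countable generation
  -- then makes them equal for almost every value of `X`.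
  have heq : P.map X ⊗ₘ (b ⊗ₖ κ').map Prod.swap = P.map X ⊗ₘ ((b ⊗ₖ κ').snd ⊗ₖ q) := by
    rw [Measure.compProd_map measurable_swap, hbκ, ← Measure.compProd_assoc', hm, hq,
      Measure.map_map (by fun_prop) (by fun_prop), Measure.map_map (by fun_prop) (by fun_prop)]
    rfl
  have := Kernel.IsMarkovKernel.map (b ⊗ₖ κ') measurable_swap
  filter_upwards [Kernel.ae_eq_of_compProd_eq heq] with x hx
  rwa [Kernel.map_apply _ measurable_swap, Kernel.compProd_apply_eq_compProd_sectR,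
    Kernel.compProd_apply_eq_compProd_sectR] at hx

/-- The expected mutual information of `C` and `Y` under the conditional laws given `X` is the
decrease of the conditional entropy of `C`. -/
theorem integral_mutualInfo_eq [MeasurableSpace.CountablyGenerated β]
    (hC : Measurable C) (hX : Measurable X) (hY : Measurable Y)
    {b : Kernel α (Fin N)} [IsMarkovKernel b] (hb : P.map X ⊗ₘ b = P.map fun ω => (X ω, C ω))
    {κ : Kernel (Fin N × α) β} [IsMarkovKernel κ]
    (hκ : P.map (fun ω => ((C ω, X ω), Y ω)) = P.map (fun ω => (C ω, X ω)) ⊗ₘ κ)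
    {q : Kernel (α × β) (Fin N)} [IsMarkovKernel q]
    (hq : P.map (fun ω => (X ω, Y ω)) ⊗ₘ q = P.map fun ω => ((X ω, Y ω), C ω)) :
    Integrable (fun ω => mutualInfo
      (b (X ω) ⊗ₘ (κ.comap Prod.swap measurable_swap).sectR (X ω))) P ∧
    ∫ ω, mutualInfo (b (X ω) ⊗ₘ (κ.comap Prod.swap measurable_swap).sectR (X ω)) ∂P =
      ∫ ω, entropy (b (X ω)) ∂P - ∫ ω, entropy (q (X ω, Y ω)) ∂P := by
  obtain ⟨m, hm, hmXY, hae⟩ := ae_map_swap_compProd_eq hC hX hY hb hκ hq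
  have := Measure.isProbabilityMeasure_map hX.aemeasurable (μ := P)
  have hXY : Measurable fun ω => (X ω, Y ω) := hX.prodMk hY
  have := Measure.isProbabilityMeasure_map hXY.aemeasurable (μ := P)
  have hqi : Integrable (fun p => entropy (q p)) (P.map X ⊗ₘ m) := integrable_entropy q _
  have hqm : Integrable (fun x => ∫ y, entropy (q (x, y)) ∂m x) (P.map X) := by
    refine Integrable.of_bound (measurable_entropy
      q).stronglyMeasurable.integral_kernel_prod_right'.aestronglyMeasurable (Real.log N)
      (Filter.Eventually.of_forall fun x => ?_)
    refine (norm_integral_le_of_norm_le_const (C := Real.log N)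
      (Filter.Eventually.of_forall fun y => ?_)).trans (by simp)
    rw [Real.norm_of_nonneg (entropy_nonneg _)]
    exact entropy_le_log _
  have hinfo : ∀ᵐ ω ∂P,
      mutualInfo (b (X ω) ⊗ₘ (κ.comap Prod.swap measurable_swap).sectR (X ω)) =
        entropy (b (X ω)) - ∫ y, entropy (q (X ω, y)) ∂m (X ω) := by
    filter_upwards [ae_of_ae_map hX.aemeasurable hae] with ω hω
    rw [mutualInfo_eq_entropy_sub hω, Measure.fst_compProd]
    rfl
  have hbi : Integrable (fun ω => entropy (b (X ω))) P :=
    (integrable_entropy b (P.map X)).comp_measurable hX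
  have hqi' : Integrable (fun ω => ∫ y, entropy (q (X ω, y)) ∂m (X ω)) P :=
    hqm.comp_measurable hX
  refine ⟨(hbi.sub hqi').congr (hinfo.mono fun _ h => h.symm), ?_⟩
  rw [integral_congr_ae hinfo, integral_sub hbi hqi',
    ← integral_map hXY.aemeasurable (measurable_entropy q).aestronglyMeasurable, ← hmXY,
    Measure.integral_compProd hqi, integral_map hX.aemeasurable]
  exact hqm.aestronglyMeasurable

end Bayes
end CPOMDP

namespace CPOMDP

/-! ### Values of policies and the regret of one episode under a fixed belief. -/

section Value

variable {N : ℕ} {S A O : Type*} [MeasurableSpace S] [MeasurableSpace A] [MeasurableSpace O]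
  (M : CPOMDP N S A O) {T : ℕ} {R : ℝ}

theorem measurable_sum_reward (T : ℕ) (c : Fin N) :
    Measurable fun x : Traj S A O T =>
      ∑ t : Fin T, M.reward c (x.1 t.castSucc).1 (x.2 t) := by
  refine Finset.measurable_sum _ fun t _ => ?_
  exact (M.reward_measurable c).comp
    (by fun_prop : Measurable fun x : Traj S A O T => ((x.1 t.castSucc).1, x.2 t))

theorem measurable_value {H : Type*} [MeasurableSpace H] {sel : H → Policy A O} {c : Fin N}
    (hsel : Measurable fun h => M.trajLaw c (sel h) T) :
    Measurable fun h => M.value T c (sel h) := by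
  let κ : Kernel H (Traj S A O T) := ⟨fun h => M.trajLaw c (sel h) T, hsel⟩
  have : IsMarkovKernel κ := ⟨fun h => inferInstanceAs (IsProbabilityMeasure (M.trajLaw _ _ _))⟩
  exact (StronglyMeasurable.integral_kernel (κ := κ)
    (measurable_sum_reward M T c).stronglyMeasurable).measurable

theorem abs_value_le (hR : ∀ c s a, |M.reward c s a| ≤ R) (c : Fin N) (π : Policy A O) :
    |M.value T c π| ≤ T * R := by
  rw [← mul_one (T * R), ← probReal_univ (μ := M.trajLaw c π T), value, ← Real.norm_eq_abs]
  refine norm_integral_le_of_norm_le_const (Filter.Eventually.of_forall fun x => ?_)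
  exact (norm_sum_le _ _).trans ((Finset.sum_le_sum fun t _ => hR c _ _).trans (by simp))

theorem expectedValue_eq_sum (b : Measure (Fin N)) [IsProbabilityMeasure b] (π : Policy A O) :
    M.expectedValue T b π = ∑ c, b.real {c} * M.value T c π :=
  integral_fintype Integrable.of_finite

/-- Comparison of a policy that maximizes value plus weighted information gain with the policy that
is optimal for the most probable context. -/
theorem sum_regret_le (hR : ∀ c s a, |M.reward c s a| ≤ R) {τ : ℝ} (hτ : 0 ≤ τ)
    (b : Measure (Fin N)) [IsProbabilityMeasure b] {Pol : Set (Policy A O)}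
    {πstar : Fin N → Policy A O} (hstar : ∀ c, πstar c ∈ Pol) {π : Policy A O}
    (hπ : IsMaxOn (fun π => M.expectedValue T b π + τ * M.infoGain T b π) Pol π) :
    ∑ c, b.real {c} * (M.value T c (πstar c) - M.value T c π) ≤
      2 * (T * R) * min 1 (entropy b) + τ * M.infoGain T b π := by
  obtain ⟨i, hi⟩ := exists_one_sub_le_entropy b
  have hmax := hπ (hstar i)
  simp only [Set.mem_ofPred_eq, expectedValue_eq_sum] at hmax
  have hI : 0 ≤ τ * M.infoGain T b (πstar i) := mul_nonneg hτ ENNReal.toReal_nonneg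
  have hTR : 0 ≤ T * R := (abs_nonneg _).trans (abs_value_le M hR i π)
  -- The term `c = i` vanishes, and any other gap is at most `2 * (T * R)`.
  have hgap : ∑ c, b.real {c} * (M.value T c (πstar c) - M.value T c (πstar i)) ≤
      2 * (T * R) * (1 - b.real {i}) := by
    calc ∑ c, b.real {c} * (M.value T c (πstar c) - M.value T c (πstar i))
        ≤ ∑ c, (2 * (T * R) * b.real {c} - if c = i then 2 * (T * R) * b.real {i} else 0) := by
          refine Finset.sum_le_sum fun c _ => ?_
          split_ifs with hc
          · simp [hc]
          · have h1 := abs_le.1 (abs_value_le M hR c (πstar c) (T := T))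
            have h2 := abs_le.1 (abs_value_le M hR c (πstar i) (T := T))
            have h3 : M.value T c (πstar c) - M.value T c (πstar i) ≤ 2 * (T * R) := by linarith
            linarith [mul_le_mul_of_nonneg_left h3 (measureReal_nonneg (μ := b) (s := {c}))]
      _ = 2 * (T * R) * (1 - b.real {i}) := by
          rw [Finset.sum_sub_distrib, ← Finset.mul_sum, sum_real_singleton_eq_one]
          simp; ring
  -- The bound by `1` is kept next to the entropy bound: it later supplies the factor `K` under the
  -- square root.
  have hmin : 1 - b.real {i} ≤ min 1 (entropy b) :=
    le_min (by linarith [measureReal_nonneg (μ := b) (s := {i})]) hi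
  have := mul_le_mul_of_nonneg_left hmin (by linarith : 0 ≤ 2 * (T * R))
  simp only [mul_sub, Finset.sum_sub_distrib] at hgap ⊢
  linarith

end Value

/-- Conditioning a bounded function of a finite-valued random variable `C` and of `X` on `X`. -/
theorem integral_eq_integral_sum_condDistrib {N : ℕ} [NeZero N] {Ω α : Type*} [MeasurableSpace Ω]
    [MeasurableSpace α] {P : Measure Ω} [IsProbabilityMeasure P] {C : Ω → Fin N} {X : Ω → α}
    (hC : Measurable C) (hX : Measurable X) {f : Fin N → α → ℝ} (hf : ∀ c, Measurable (f c))
    {B : ℝ} (hB : ∀ c x, |f c x| ≤ B) :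
    Integrable (fun ω => f (C ω) (X ω)) P ∧
    Integrable (fun ω => ∑ c, (condDistrib C X P (X ω)).real {c} * f c (X ω)) P ∧
    ∫ ω, f (C ω) (X ω) ∂P = ∫ ω, ∑ c, (condDistrib C X P (X ω)).real {c} * f c (X ω) ∂P := by
  have hF : Measurable fun p : α × Fin N => f p.2 p.1 :=
    measurable_from_prod_countable_left fun c => hf c
  have := Measure.isProbabilityMeasure_map hX.aemeasurable (μ := P)
  have hFi : Integrable (fun p : α × Fin N => f p.2 p.1) (P.map X ⊗ₘ condDistrib C X P) :=
    Integrable.of_bound hF.aestronglyMeasurable B (Filter.Eventually.of_forall fun p => hB _ _)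
  have hsum : Measurable fun x => ∑ c, (condDistrib C X P x).real {c} * f c x := by
    refine Finset.measurable_sum _ fun c _ => Measurable.mul ?_ (hf c)
    exact ((condDistrib C X P).measurable_coe (measurableSet_singleton c)).ennreal_toReal
  refine ⟨Integrable.of_bound (hF.comp (hX.prodMk hC)).aestronglyMeasurable B
    (Filter.Eventually.of_forall fun ω => hB _ _),
    Integrable.of_bound (hsum.comp hX).aestronglyMeasurable B
      (Filter.Eventually.of_forall fun ω => ?_), ?_⟩
  · calc ‖∑ c, (condDistrib C X P (X ω)).real {c} * f c (X ω)‖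
        ≤ ∑ c, (condDistrib C X P (X ω)).real {c} * B := by
          refine (norm_sum_le _ _).trans (Finset.sum_le_sum fun c _ => ?_)
          rw [norm_mul, Real.norm_of_nonneg measureReal_nonneg]
          exact mul_le_mul_of_nonneg_left (hB _ _) measureReal_nonneg
      _ = B := by rw [← Finset.sum_mul, sum_real_singleton_eq_one, one_mul]
  · calc ∫ ω, f (C ω) (X ω) ∂P
        = ∫ p, f p.2 p.1 ∂(P.map fun ω => (X ω, C ω)) :=
          (integral_map (hX.prodMk hC).aemeasurable hF.aestronglyMeasurable).symm
      _ = ∫ x, ∫ c, f c x ∂(condDistrib C X P x) ∂(P.map X) := by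
          rw [← compProd_map_condDistrib hC.aemeasurable, Measure.integral_compProd hFi]
      _ = ∫ x, ∑ c, (condDistrib C X P x).real {c} * f c x ∂(P.map X) := by
          refine integral_congr_ae (Filter.Eventually.of_forall fun x => ?_)
          exact integral_fintype Integrable.of_finite
      _ = _ := integral_map hX.aemeasurable hsum.aestronglyMeasurable

/-! ### Chain rule and summation over the episodes. -/

namespace Interaction

variable {N : ℕ} {S A O Ω : Type*} [MeasurableSpace S] [MeasurableSpace A]
  [MeasurableSpace O] [MeasurableSpace Ω] {M : CPOMDP N S A O} {T K : ℕ}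
  {prior : Measure (Fin N)} {P : Measure Ω} (X : Interaction M T K prior P)

theorem hist_measurable (k : ℕ) : Measurable (X.hist k) :=
  measurable_pi_lambda _ fun i => X.obs_measurable i

theorem hist_succ (k : ℕ) (ω : Ω) :
    X.hist (k + 1) ω = Fin.snoc (α := fun _ => ObsTraj A O T) (X.hist k ω) (X.obs k ω) := by
  refine funext fun i => Fin.lastCases ?_ (fun j => ?_) i
  · simp [hist]
  · simp [hist]

theorem measurable_snoc_hist (k : ℕ) :
    Measurable fun p : (Fin k → ObsTraj A O T) × ObsTraj A O T =>
      Fin.snoc (α := fun _ => ObsTraj A O T) p.1 p.2 := by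
  refine measurable_pi_lambda _ fun i => Fin.lastCases ?_ (fun j => ?_) i
  · simpa using measurable_snd
  · simp only [Fin.snoc_castSucc]; fun_prop

instance isMarkovKernel_episodeKernel (k : ℕ) :
    IsMarkovKernel (M.episodeKernel T (X.sel k) (X.sel_measurable k)) :=
  ⟨fun p => Measure.isProbabilityMeasure_map (μ := M.trajLaw p.1 (X.sel k p.2) T)
    measurable_observed.aemeasurable⟩

variable [NeZero N] [IsProbabilityMeasure P]

instance isProbabilityMeasure_posterior (k : ℕ) (ω : Ω) :
    IsProbabilityMeasure (X.posterior k ω) := by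
  unfold posterior; infer_instance

theorem integrable_entropy_posterior (k : ℕ) :
    Integrable (fun ω => entropy (X.posterior k ω)) P :=
  have := Measure.isProbabilityMeasure_map (X.hist_measurable k).aemeasurable (μ := P)
  (integrable_entropy (condDistrib X.ctx (X.hist k) P) (P.map (X.hist k))).comp_measurable
    (X.hist_measurable k)

theorem condEntropy_nonneg (k : ℕ) : 0 ≤ X.condEntropy k :=
  integral_nonneg fun _ => entropy_nonneg _

theorem condEntropy_le_log (k : ℕ) : X.condEntropy k ≤ Real.log N :=
  (integral_mono (X.integrable_entropy_posterior k) (integrable_const _)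
    fun _ => entropy_le_log _).trans (by simp)

variable [MeasurableSpace.CountablyGenerated A] [MeasurableSpace.CountablyGenerated O]

/-- Chain rule: the information gained in an episode is the decrease of the conditional entropy. -/
theorem condMutualInfo_eq {k : ℕ} (hk : k < K) :
    Integrable (fun ω => M.infoGain T (X.posterior k ω) (X.policy k ω)) P ∧
    X.condMutualInfo k = X.condEntropy k - X.condEntropy (k + 1) := by
  have hC := X.ctx_measurable
  have hX := X.hist_measurable k
  have hX' := X.hist_measurable (k + 1)
  have hY := X.obs_measurable k
  have := Measure.isProbabilityMeasure_map (hX.prodMk hY).aemeasurable (μ := P)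
  have := Measure.isProbabilityMeasure_map hX'.aemeasurable (μ := P)
  set q' := condDistrib X.ctx (X.hist (k + 1)) P
  -- The posterior of the next episode, read as a kernel on pairs (past, new trajectory), so that
  -- its mean entropy is `condEntropy (k + 1)`.
  let q := q'.comap _ (measurable_snoc_hist (A := A) (O := O) (T := T) k)
  have hq : P.map (fun ω => (X.hist k ω, X.obs k ω)) ⊗ₘ q =
      P.map fun ω => ((X.hist k ω, X.obs k ω), X.ctx ω) := by
    let g : (Fin (k + 1) → ObsTraj A O T) → (Fin k → ObsTraj A O T) × ObsTraj A O T :=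
      fun h => (fun i => h i.castSucc, h (Fin.last k))
    have hg : Measurable g := by fun_prop
    have e : P.map (fun ω => ((X.hist k ω, X.obs k ω), X.ctx ω)) =
        (P.map fun ω => (X.hist (k + 1) ω, X.ctx ω)).map (Prod.map g id) := by
      rw [Measure.map_map (hg.prodMap measurable_id) (hX'.prodMk hC)]; rfl
    rw [e, ← compProd_map_condDistrib hC.aemeasurable]
    ext s hs
    rw [Measure.map_apply (hg.prodMap measurable_id) hs, Measure.compProd_apply hs,
      Measure.compProd_apply ((hg.prodMap measurable_id) hs),
      lintegral_map (Kernel.measurable_kernel_prodMk_left hs) (hX.prodMk hY),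
      lintegral_map (Kernel.measurable_kernel_prodMk_left ((hg.prodMap measurable_id) hs)) hX']
    refine lintegral_congr fun ω => ?_
    rw [Kernel.comap_apply, ← X.hist_succ]
    rfl
  obtain ⟨h1, h2⟩ := integral_mutualInfo_eq hC hX hY
    (compProd_map_condDistrib hC.aemeasurable) (X.obs_law k hk) hq
  refine ⟨h1, h2.trans ?_⟩
  congr 1
  refine integral_congr_ae (Filter.Eventually.of_forall fun ω => ?_)
  simp only [q, Kernel.comap_apply, ← X.hist_succ]
  rfl

/-- The expected regret of one episode. -/
theorem integral_episode_regret_le {R τ : ℝ} (hR : ∀ c s a, |M.reward c s a| ≤ R) (hτ : 0 ≤ τ)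
    {Pol : Set (Policy A O)} {πstar : Fin N → Policy A O} (hstar : ∀ c, πstar c ∈ Pol)
    (hX : X.IsCIDS Pol τ) {k : ℕ} (hk : k < K) :
    Integrable (fun ω => M.value T (X.ctx ω) (πstar (X.ctx ω)) -
      M.value T (X.ctx ω) (X.policy k ω)) P ∧
    ∫ ω, (M.value T (X.ctx ω) (πstar (X.ctx ω)) - M.value T (X.ctx ω) (X.policy k ω)) ∂P ≤
      2 * (T * R) * min 1 (X.condEntropy k) + τ * X.condMutualInfo k := by
  obtain ⟨h1, h2, h3⟩ := integral_eq_integral_sum_condDistrib (P := P) X.ctx_measurable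
    (X.hist_measurable k)
    (f := fun c h => M.value T c (πstar c) - M.value T c (X.sel k h)) (B := T * R + T * R)
    (fun c => (M.measurable_value (X.sel_measurable k c)).const_sub _)
    (fun c h => (abs_sub _ _).trans (add_le_add (M.abs_value_le hR _ _) (M.abs_value_le hR _ _)))
  have hTR : 0 ≤ T * R := (abs_nonneg _).trans (M.abs_value_le hR 0 (πstar 0))
  have hI := (X.condMutualInfo_eq hk).1
  have hE := X.integrable_entropy_posterior k
  have hmin : Integrable (fun ω => min 1 (entropy (X.posterior k ω))) P :=
    (integrable_const 1).inf hE
  refine ⟨h1, h3.le.trans ?_⟩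
  calc _ ≤ ∫ ω, (2 * (T * R) * min 1 (entropy (X.posterior k ω)) +
        τ * M.infoGain T (X.posterior k ω) (X.policy k ω)) ∂P := by
        refine integral_mono_ae h2 ((hmin.const_mul _).add (hI.const_mul _)) ?_
        filter_upwards [hX k hk] with ω hω
        exact M.sum_regret_le hR hτ (X.posterior k ω) hstar hω.2
    _ = 2 * (T * R) * ∫ ω, min 1 (entropy (X.posterior k ω)) ∂P + τ * X.condMutualInfo k := by
        rw [integral_add (hmin.const_mul _) (hI.const_mul _), integral_const_mul,
          integral_const_mul, condMutualInfo]
    _ ≤ _ := by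
        -- Jensen's inequality for the concave `min 1`, by bounding against each of its two
        -- arguments.
        gcongr
        refine le_min ?_ (integral_mono hmin hE fun ω => min_le_right _ _)
        exact (integral_mono hmin (integrable_const 1) fun ω => min_le_left _ _).trans (by simp)

theorem sum_condMutualInfo_eq :
    ∑ k ∈ Finset.range K, X.condMutualInfo k = X.condEntropy 0 - X.condEntropy K := by
  rw [← Finset.sum_range_sub' X.condEntropy K]
  exact Finset.sum_congr rfl fun k hk => (X.condMutualInfo_eq (Finset.mem_range.1 hk)).2

/-- The expected regret is controlled by the initial entropy of the context. -/
theorem integral_regret_le {R τ η : ℝ} (hR : ∀ c s a, |M.reward c s a| ≤ R) (hτ : 0 ≤ τ)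
    {Pol : Set (Policy A O)} {πstar : Fin N → Policy A O} (hstar : ∀ c, πstar c ∈ Pol)
    (hX : X.IsCIDS Pol τ) (hη : X.IsInfoConstant η) :
    Integrable (X.regret πstar) P ∧
    ∫ ω, X.regret πstar ω ∂P ≤
      2 * (T * R) * √(K * X.condEntropy 0 / η) + τ * X.condEntropy 0 := by
  have hep := fun k hk => X.integral_episode_regret_le hR hτ hstar hX (k := k) hk
  have hTR : 0 ≤ T * R := (abs_nonneg _).trans (M.abs_value_le hR 0 (πstar 0))
  have hI : ∑ k ∈ Finset.range K, X.condMutualInfo k ≤ X.condEntropy 0 := by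
    rw [X.sum_condMutualInfo_eq]; linarith [X.condEntropy_nonneg K]
  have hH : ∑ k ∈ Finset.range K, X.condEntropy k ≤ X.condEntropy 0 / η := by
    calc ∑ k ∈ Finset.range K, X.condEntropy k
        ≤ ∑ k ∈ Finset.range K, 1 / η * X.condMutualInfo k :=
          Finset.sum_le_sum fun k hk => hη.2 k (Finset.mem_range.1 hk)
      _ ≤ 1 / η * X.condEntropy 0 := by
          rw [← Finset.mul_sum]
          exact mul_le_mul_of_nonneg_left hI (one_div_pos.2 hη.1).le
      _ = X.condEntropy 0 / η := by ring
  -- The square of the sum is at most the product of its two upper bounds, `K` and `condEntropy 0 /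
  -- η`.
  have hmin : ∑ k ∈ Finset.range K, min 1 (X.condEntropy k) ≤ √(K * X.condEntropy 0 / η) := by
    have h0 : 0 ≤ ∑ k ∈ Finset.range K, min 1 (X.condEntropy k) :=
      Finset.sum_nonneg fun k _ => le_min zero_le_one (X.condEntropy_nonneg k)
    have h1 : ∑ k ∈ Finset.range K, min 1 (X.condEntropy k) ≤ K :=
      (Finset.sum_le_sum fun k _ => min_le_left _ _).trans (by simp)
    have h2 := (Finset.sum_le_sum fun k (_ : k ∈ Finset.range K) =>
      min_le_right 1 (X.condEntropy k)).trans hH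
    refine Real.le_sqrt_of_sq_le ?_
    rw [sq, mul_div_assoc]
    exact mul_le_mul h1 h2 h0 (Nat.cast_nonneg K)
  refine ⟨integrable_finsetSum _ fun k hk => (hep k (Finset.mem_range.1 hk)).1, ?_⟩
  unfold regret
  rw [integral_finsetSum _ fun k hk => (hep k (Finset.mem_range.1 hk)).1]
  refine (Finset.sum_le_sum fun k hk => (hep k (Finset.mem_range.1 hk)).2).trans ?_
  rw [Finset.sum_add_distrib, ← Finset.mul_sum, ← Finset.mul_sum]
  gcongr

/-- The first episode cannot reveal more than the initial entropy: `η * H₀ ≤ H₀ - H₁ ≤ H₀`. With `η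
≤ 1`, the threshold for `K` can be chosen independently of `η`. -/
theorem le_one_of_isInfoConstant {η : ℝ} (hη : X.IsInfoConstant η) (hK : 0 < K)
    (h0 : 0 < X.condEntropy 0) : η ≤ 1 := by
  have h1 := hη.2 0 hK
  rw [(X.condMutualInfo_eq hK).2, one_div, inv_mul_eq_div, le_div_iff₀ hη.1] at h1
  have h2 := X.condEntropy_nonneg (0 + 1)
  refine le_of_mul_le_mul_left ?_ h0
  linarith

end Interaction

end CPOMDP

/-! ### Choice of the constants. -/

theorem mainTheorem1 :
    ∃ ξ > (0 : ℝ), ∃ κ > (0 : ℝ),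
      ∀ (N : ℕ) [NeZero N] (T : ℕ) (Rmax τ : ℝ), 0 < Rmax → 0 < τ →
      ∃ K₀ : ℕ,
        ∀ (S : Type*) (A : Type*) (O : Type*) (Ω : Type*)
          [MeasurableSpace S] [MeasurableSpace A] [MeasurableSpace O] [MeasurableSpace Ω]
          [MeasurableSpace.CountablyGenerated A] [MeasurableSpace.CountablyGenerated O]
          (M : CPOMDP N S A O) (_ : ∀ c s a, |M.reward c s a| ≤ Rmax)
          (prior : Measure (Fin N)) (P : Measure Ω) [IsProbabilityMeasure P]
          (Pol : Set (CPOMDP.Policy A O)) (πstar : Fin N → CPOMDP.Policy A O)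
          (_ : ∀ c, πstar c ∈ Pol ∧ IsMaxOn (M.value T c) Pol (πstar c))
          (K : ℕ) (X : CPOMDP.Interaction M T K prior P) (_ : X.IsCIDS Pol τ)
          (η : ℝ) (_ : X.IsInfoConstant η),
          Integrable (X.regret πstar) P ∧
          ∫ ω, X.regret πstar ω ∂P ≤
            τ * Real.log N + ξ * T * Rmax * √(K * Real.log N / η) + 2 * T * Rmax * √(K * T) ∧
          (K₀ ≤ K → ∫ ω, X.regret πstar ω ∂P ≤ κ * (T * Rmax * √(K * Real.log N / η))) := by
  -- `ξ = 2` comes from the value gap `2 * (T * R)`; `κ = 3` adds one unit that absorbs `τ * log N`.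
  -- The threshold is where this absorption begins, and its `+ 1` forces `K > 0`. For `T = 0` the
  -- quotient is `0` by convention.
  refine ⟨2, by norm_num, 3, by norm_num, fun N _ T R τ hR hτ =>
    ⟨⌈τ ^ 2 * Real.log N / (T * R) ^ 2⌉₊ + 1, ?_⟩⟩
  intro S A O Ω _ _ _ _ _ _ M hM prior P _ Pol πstar hstar K X hX η hη
  obtain ⟨hint, hle⟩ := X.integral_regret_le hM hτ.le (fun c => (hstar c).1) hX hη
  have hη0 := hη.1
  have hTR : 0 ≤ T * R := by positivity
  have hsqrt : √(K * X.condEntropy 0 / η) ≤ √(K * Real.log N / η) := by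
    gcongr; exact X.condEntropy_le_log 0
  have hent : τ * X.condEntropy 0 ≤ τ * Real.log N := by
    gcongr; exact X.condEntropy_le_log 0
  have hlead : 2 * (T * R) * √(K * X.condEntropy 0 / η) ≤
      2 * (T * R) * √(K * Real.log N / η) := by gcongr
  refine ⟨hint, ?_, fun hK => ?_⟩
  -- The last summand of the bound is slack: the first two already suffice.
  · have : 0 ≤ 2 * T * R * √(K * T) := by positivity
    linarith
  · have hlog : 0 ≤ Real.log N := Real.log_natCast_nonneg N
    have hrhs : 0 ≤ T * R * √(K * Real.log N / η) := by positivity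
    -- With zero initial entropy `η` may exceed `1`, but the expected regret is then at most `0`.
    rcases (X.condEntropy_nonneg 0).eq_or_lt with h0 | h0
    · rw [← h0] at hle
      simp only [mul_zero, zero_div, Real.sqrt_zero, add_zero] at hle
      linarith
    rcases Nat.eq_zero_or_pos T with rfl | hT
    · have : ∀ ω, X.regret πstar ω = 0 := fun ω => by
        simp [CPOMDP.Interaction.regret, CPOMDP.value]
      simp [this]
    have hη1 := X.le_one_of_isInfoConstant hη (by omega) h0
    have hTR' : 0 < T * R := by positivity
    have hK' : τ ^ 2 * Real.log N / (T * R) ^ 2 ≤ K :=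
      (Nat.le_ceil _).trans (by exact_mod_cast (Nat.le_succ _).trans hK)
    rw [div_le_iff₀ (by positivity)] at hK'
    -- The square of `τ * log N / (T * R)` is at most `K * log N` by the threshold, and dividing by
    -- `η ≤ 1` only enlarges the latter.
    have hτlog : τ * Real.log N ≤ T * R * √(K * Real.log N / η) := by
      rw [← div_le_iff₀' hTR']
      refine Real.le_sqrt_of_sq_le ?_
      have h1 : (τ * Real.log N / (T * R)) ^ 2 ≤ K * Real.log N := by
        rw [div_pow, div_le_iff₀ (by positivity)]
        nlinarith [mul_le_mul_of_nonneg_right hK' hlog]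
      refine h1.trans ((le_div_iff₀ hη0).2 ?_)
      exact mul_le_of_le_one_right (by positivity) hη1
    linarith
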